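/- For a finite non-empty simple graph $G=(V,E)$, let $\mathcal{IG}(G)$ be the random independent set returned by the randomized greedy algorithm, which repeatedly chooses a node uniformly at random among all remaining nodes, adds it to the independent set, deletes it and all remaining nodes adjacent to it, and stops when no node remains. For integers $g,r$ let $G(g,r)$ be the class of all finite non-empty simple $r$-regular graphs of girth (length of a shortest cycle) at least $g$. Theorem 4. For every $g\ge 4$ and $r\ge 3$, \begin{align*} \frac{1-(r-1)^{-\frac{2}{r-2}}}{2}-\frac{r(r-1)^{\lfloor\frac{g-2}{2}\rfloor}}{(\lfloor\frac{g-2}{2}\rfloor+1)!} &\le \inf_{G\in G(g,r)}\mathbb{E}\left[\frac{|\mathcal{IG}(G)|}{|V(G)|}\right] \le \sup_{G\in G(g,r)}\mathbb{E}\left[\frac{|\mathcal{IG}(G)|}{|V(G)|}\right]\\ &\le \frac{1-(r-1)^{-\frac{2}{r-2}}}{2}+\frac{r(r-1)^{\lfloor\frac{g-2}{2}\rfloor}}{(\lfloor\frac{g-2}{2}\rfloor+1)!}. \end{align*} -/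

import Mathlib

universe u

/-- The randomized greedy algorithm, run on the subgraph of `G` induced by the set `R` of remaining
nodes: while `R` is non-empty, pick a node `i` uniformly at random from `R`, put `i` into the
independent set, delete `i` and all its neighbours from `R`, and repeat with fresh randomness.
The value is the law of the resulting random set. -/
noncomputable def greedyFrom {V : Type u} [DecidableEq V] (G : SimpleGraph V)
    [DecidableRel G.Adj] (R : Finset V) : PMF (Finset V) :=
  if h : R.Nonempty then
    haveI : Nonempty {x // x ∈ R} := h.to_subtype
    (PMF.uniformOfFintype {x // x ∈ R}).bind fun i =>
      (greedyFrom G ((R.erase i.1).filter fun j => ¬ G.Adj i.1 j)).map (insert i.1)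
  else PMF.pure ∅
termination_by R.card
decreasing_by
  exact lt_of_le_of_lt (Finset.card_le_card (Finset.filter_subset _ _))
    (Finset.card_erase_lt_of_mem i.2)

/-- The law of the random independent set returned by the greedy algorithm on the whole graph. -/
noncomputable def greedyIndepSet {V : Type u} [Fintype V] [DecidableEq V] (G : SimpleGraph V)
    [DecidableRel G.Adj] : PMF (Finset V) :=
  greedyFrom G Finset.univ

/-- The expectation `𝔼[|IG| / |V|]`, where `IG` is the greedy random independent set of `G`. -/
noncomputable def expectedGreedyRatio {V : Type u} [Fintype V] [DecidableEq V]
    (G : SimpleGraph V) [DecidableRel G.Adj] : ℝ :=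
  ∑ I : Finset V, (greedyIndepSet G I).toReal * ((I.card : ℝ) / (Fintype.card V : ℝ))

/-- The class of finite non-empty simple `r`-regular graphs of girth at least `g`. -/
structure RegularGirthGraph (g r : ℕ) : Type (u + 1) where
  /-- the nodes -/
  V : Type u
  [fintype : Fintype V]
  [decidableEq : DecidableEq V]
  [nonempty : Nonempty V]
  /-- the graph -/
  graph : SimpleGraph V
  [decidableAdj : DecidableRel graph.Adj]
  regular : graph.IsRegularOfDegree r
  girth : (g : ℕ∞) ≤ graph.egirth

attribute [instance] RegularGirthGraph.fintype
attribute [instance] RegularGirthGraph.decidableEq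
attribute [instance] RegularGirthGraph.nonempty
attribute [instance] RegularGirthGraph.decidableAdj

/-- The infimum of `𝔼[|IG| / |V|]` over the `r`-regular graphs of girth at least `g`; it is taken in
the extended reals, so that it exists unconditionally. -/
noncomputable def infGreedyRatio (g r : ℕ) : EReal :=
  ⨅ G : RegularGirthGraph.{u} g r, (expectedGreedyRatio G.graph : EReal)

/-- The supremum of `𝔼[|IG| / |V|]` over the `r`-regular graphs of girth at least `g`. -/
noncomputable def supGreedyRatio (g r : ℕ) : EReal :=
  ⨆ G : RegularGirthGraph.{u} g r, (expectedGreedyRatio G.graph : EReal)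

/-- The limiting density `(1 - (r-1)^{-2/(r-2)}) / 2`. -/
noncomputable def greedyDensity (r : ℕ) : ℝ :=
  (1 - ((r : ℝ) - 1) ^ (-(2 / ((r : ℝ) - 2)))) / 2

/-- The finite girth correction `r (r-1)^⌊(g-2)/2⌋ / (⌊(g-2)/2⌋ + 1)!`, used for `g ≥ 4`. -/
noncomputable def girthCorrection (g r : ℕ) : ℝ :=
  (r : ℝ) * ((r : ℝ) - 1) ^ ((g - 2) / 2) / (((g - 2) / 2 + 1).factorial : ℝ)

/-! Inspecting the nodes in a uniformly random order gives the same law as the greedy algorithm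
(`orderMean_greedyList`), and the order may be generated by independent uniform weights
(`orderMean_eq_integral`). A node is selected iff no neighbour of smaller weight is selected, so its
indicator is a product over its neighbours. Cutting this recursion off at some depth with the value
0 gives alternately lower and upper bounds, because each level reverses inequalities
(`indicator_greedyList_bounds`).

If the girth exceeds `2 * k`, the branches seen by the recursion of depth `k + 1` are disjoint,
hence independent, and its mean is the number `T k = ∫ (1 - treeProb (r - 1) k) ^ r` of the infinite
`r`-regular tree (`integral_truncatedGreedy_self`). The functions `treeProb` are the iterates of the
order-reversing operator `A ↦ ∫ (1 - A) ^ (r - 1)`, started at 0. The fixed point `limitProb` of the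
operator is explicit and yields `greedyDensity`, which therefore also lies between consecutive `T
k`.

So the expected ratio and the limiting density both lie between `T k` and `T (k + 1)`, and a
Picard-type estimate bounds the gap by `r * (r - 1) ^ k / (k + 2)!`. The inequality between infimum
and supremum needs a non-empty class; a Cayley graph of involutions acting on reduced words supplies
a member. -/

/-! ### Non-backtracking walks below the girth -/

namespace SimpleGraph

/-- A non-backtracking walk that is shorter than the girth is a path. -/
theorem Walk.isPath_of_isChain_of_length_lt_egirth {V : Type*} {G : SimpleGraph V} {u v : V}
    (w : G.Walk u v) (hc : w.edges.IsChain (· ≠ ·)) (hl : (w.length : ℕ∞) < G.egirth) :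
    w.IsPath := by
  classical
  let H : SimpleGraph V := fromEdgeSet {e | e ∈ w.edges}
  have hHG : H ≤ G := by
    intro a b hab
    exact w.edges_subset_edgeSet ((fromEdgeSet_adj _).1 hab).1
  have hp : ∀ e ∈ w.edges, e ∈ H.edgeSet := by
    intro e he
    rw [edgeSet_fromEdgeSet]
    exact ⟨he, G.not_isDiag_of_mem_edgeSet (w.edges_subset_edgeSet he)⟩
  -- A cycle in the subgraph formed by the edges of `w` has distinct edges, so it is no longer than
  -- `w`, which is shorter than the girth. In a forest a non-backtracking walk is a path.
  have hH : H.IsAcyclic := by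
    intro a c hcyc
    have h1 : G.egirth ≤ c.length := by
      simpa using egirth_le_length (hcyc.mapLe hHG)
    have h2 : c.edges ⊆ w.edges := by
      intro e he
      have := c.edges_subset_edgeSet he
      rw [edgeSet_fromEdgeSet] at this
      exact this.1
    have h3 := (List.subperm_of_subset hcyc.edges_nodup h2).length_le
    rw [Walk.length_edges, Walk.length_edges] at h3
    exact absurd (h1.trans (by exact_mod_cast h3)) (not_le.2 hl)
  have h := (hH.isPath_iff_isChain (w.transfer H hp)).2 (by rwa [Walk.edges_transfer])
  rwa [Walk.isPath_def, Walk.support_transfer, ← Walk.isPath_def] at h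

end SimpleGraph

/-! ### Regular graphs of large girth -/

/-- Words over `Fin r` of length at most `n` without two equal consecutive letters. -/
abbrev ReducedWord (r n : ℕ) : Type :=
  {l : List (Fin r) // l.IsChain (· ≠ ·) ∧ l.length ≤ n}

namespace ReducedWord

variable {r n : ℕ}

instance : Finite (ReducedWord r n) :=
  ((List.finite_length_le (Fin r) n).subset fun _ h => h.2).to_subtype

/-- Cancel `i` if it is the first letter, otherwise prepend it if there is room. -/
def toggleFun (i : Fin r) (l : ReducedWord r n) : ReducedWord r n :=
  if h : l.1.head? = some i then ⟨l.1.tail, l.2.1.tail, by have := l.2.2; simp; omega⟩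
  else if h' : l.1.length < n then
    ⟨i :: l.1, List.isChain_cons.2 ⟨fun y hy hi => h (hi ▸ hy), l.2.1⟩, h'⟩
  else l

/-- After cancelling `i`, the rest does not start with `i` since the word is reduced, and there is
room to put `i` back. Words of full length that do not start with `i` are fixed. -/
theorem toggleFun_toggleFun (i : Fin r) (l : ReducedWord r n) :
    toggleFun i (toggleFun i l) = l := by
  obtain ⟨l, hl, hn⟩ := l
  cases l with
  | nil =>
    by_cases h' : 0 < n <;> simp [toggleFun, h']
  | cons a t =>
    by_cases h : a = i
    · subst h
      have h1 : t.head? ≠ some a := fun h2 => (List.isChain_cons.1 hl).1 a h2 rfl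
      have h3 : t.length < n := hn
      simp [toggleFun, h1, h3]
    · by_cases h' : t.length + 1 < n <;> simp [toggleFun, h, h']

/-- The involution of the reduced words that multiplies by a letter. -/
def toggle (i : Fin r) : Equiv.Perm (ReducedWord r n) :=
  (Function.Involutive.toPerm (toggleFun i) (toggleFun_toggleFun i))

theorem toggle_mul_self (i : Fin r) : (toggle i * toggle i : Equiv.Perm (ReducedWord r n)) = 1 := by
  ext1 l
  exact toggleFun_toggleFun i l

/-- The orbit of the empty word shows that no non-empty reduced word of length at most `n` is a
relation between the involutions. -/
theorem prod_toggle_nil (l : List (Fin r)) (hl : l.IsChain (· ≠ ·)) (hn : l.length ≤ n) :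
    (l.map toggle).prod (⟨[], by simp, by simp⟩ : ReducedWord r n) = ⟨l, hl, hn⟩ := by
  induction l with
  | nil => rfl
  | cons a t ih =>
    rw [List.map_cons, List.prod_cons, Equiv.Perm.mul_apply, ih hl.tail (by simp at hn; omega)]
    have h1 : t.head? ≠ some a := fun h2 => (List.isChain_cons.1 hl).1 a h2 rfl
    have h3 : t.length < n := hn
    change toggleFun a _ = _
    simp [toggleFun, h1, h3]

theorem toggle_injective (hn : 1 ≤ n) :
    Function.Injective (toggle : Fin r → Equiv.Perm (ReducedWord r n)) := by
  intro i j hij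
  have h1 := prod_toggle_nil (n := n) [i] (by simp) (by simpa)
  have h2 := prod_toggle_nil (n := n) [j] (by simp) (by simpa)
  simp only [List.map_cons, List.map_nil, hij] at h1 h2
  simpa using h1.symm.trans h2

theorem toggle_ne_one (hn : 1 ≤ n) (i : Fin r) : (toggle i : Equiv.Perm (ReducedWord r n)) ≠ 1 := by
  intro h
  have h1 := prod_toggle_nil (n := n) [i] (by simp) (by simpa)
  simp [h] at h1

/-- The Cayley graph of the group generated by the involutions `toggle i`. -/
def cayleyGraph (r n : ℕ) (hn : 1 ≤ n) : SimpleGraph (Equiv.Perm (ReducedWord r n)) where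
  Adj a b := ∃ i, b = toggle i * a
  symm := ⟨by
    rintro a b ⟨i, rfl⟩
    exact ⟨i, by rw [← mul_assoc, toggle_mul_self, one_mul]⟩⟩
  loopless := ⟨by
    rintro a ⟨i, h⟩
    exact toggle_ne_one hn i (by simpa using h.symm)⟩

/-- The letters along a trail form a reduced word: repeating a letter would go back along the edge
just used, as each `toggle i` is an involution. The clause on `l.head?` is there to carry the
induction. -/
theorem exists_word_of_isTrail (hn : 1 ≤ n) {a b : Equiv.Perm (ReducedWord r n)}
    (w : (cayleyGraph r n hn).Walk a b) (hw : w.IsTrail) :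
    ∃ l : List (Fin r), l.IsChain (· ≠ ·) ∧ l.length = w.length ∧
      (∀ i ∈ l.head?, s(a, toggle i * a) ∈ w.edges) ∧ b = (l.reverse.map toggle).prod * a := by
  induction w with
  | nil => exact ⟨[], by simp⟩
  | @cons a c b h p ih =>
    rw [SimpleGraph.Walk.isTrail_cons] at hw
    obtain ⟨l, h1, h2, h3, h4⟩ := ih hw.1
    have hi : ∃ i, c = toggle i * a := h
    obtain ⟨i, rfl⟩ := hi
    refine ⟨i :: l, List.isChain_cons.2 ⟨?_, h1⟩, ?_, ?_, ?_⟩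
    · rintro j hj rfl
      apply hw.2
      have := h3 _ hj
      rwa [← mul_assoc, toggle_mul_self, one_mul, Sym2.eq_swap] at this
    · rw [List.length_cons, SimpleGraph.Walk.length_cons, h2]
    · intro j hj
      obtain rfl : i = j := by simpa using hj
      rw [SimpleGraph.Walk.edges_cons]
      exact List.mem_cons_self
    · rw [h4]
      simp [mul_assoc]

theorem succ_le_egirth_cayleyGraph (hn : 1 ≤ n) : ((n + 1 : ℕ) : ℕ∞) ≤ (cayleyGraph r n hn).egirth := by
  rw [SimpleGraph.le_egirth]
  intro a w hw
  by_contra! hlt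
  have hlt' : w.length ≤ n := by
    have : w.length < n + 1 := by exact_mod_cast hlt
    omega
  obtain ⟨l, h1, h2, -, h4⟩ := exists_word_of_isTrail hn w hw.isTrail
  have h5 : (l.reverse.map (toggle (n := n))).prod = 1 := by simpa using h4.symm
  have h6 := prod_toggle_nil (n := n) l.reverse
    (List.isChain_reverse.2 (h1.imp fun _ _ h => h.symm)) (by simpa [h2])
  rw [h5] at h6
  have h7 : l = [] := by simpa using congrArg Subtype.val h6.symm
  have := hw.three_le_length
  simp [h7] at h2
  omega

end ReducedWord

/-- There are regular graphs of every degree and arbitrarily large girth. -/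
instance RegularGirthGraph.instNonempty (g r : ℕ) : Nonempty (RegularGirthGraph.{u} g r) := by
  classical
  have hn : 1 ≤ g + 1 := by omega
  let V := Equiv.Perm (ReducedWord r (g + 1))
  let G := ReducedWord.cayleyGraph r (g + 1) hn
  let _ : Fintype V := Fintype.ofFinite V
  let H : SimpleGraph (ULift.{u} V) := G.comap ULift.down
  have e : H ≃g G := ⟨Equiv.ulift, Iff.rfl⟩
  refine ⟨{ V := ULift.{u} V, graph := H, regular := ?_, girth := ?_ }⟩
  · intro a
    rw [← SimpleGraph.card_neighborFinset_eq_degree]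
    have : H.neighborFinset a = Finset.univ.image fun i : Fin r =>
        (ULift.up (ReducedWord.toggle i * a.down) : ULift.{u} V) := by
      ext b
      simp only [SimpleGraph.mem_neighborFinset, Finset.mem_image, Finset.mem_univ, true_and]
      exact exists_congr fun i => ⟨fun h => by cases b; exact congrArg _ h.symm, fun h => by rw [← h]⟩
    rw [this, Finset.card_image_of_injective, Finset.card_univ, Fintype.card_fin]
    intro i j hij
    exact ReducedWord.toggle_injective hn (mul_right_cancel (ULift.up_injective hij))
  · rw [e.egirth_eq]
    refine le_trans ?_ (ReducedWord.succ_le_egirth_cayleyGraph hn)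
    exact_mod_cast (by omega : g ≤ g + 1 + 1)

/-! ### Means over uniformly random orderings -/

section RandomOrder

variable {V : Type*} [DecidableEq V]

/-- The mean of `F` over a uniformly random ordering of the `n`-element set `A`. -/
noncomputable def orderMean : ℕ → Finset V → (List V → ℝ) → ℝ
  | 0, _, F => F []
  | n + 1, A, F => (∑ i ∈ A, orderMean n (A.erase i) fun l => F (i :: l)) / (n + 1)

theorem orderMean_add (n : ℕ) (A : Finset V) (F F' : List V → ℝ) :
    orderMean n A (fun l => F l + F' l) = orderMean n A F + orderMean n A F' := by
  induction n generalizing A F F' with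
  | zero => rfl
  | succ n ih => simp only [orderMean, ih, Finset.sum_add_distrib, add_div]

theorem orderMean_const_mul (n : ℕ) (A : Finset V) (c : ℝ) (F : List V → ℝ) :
    orderMean n A (fun l => c * F l) = c * orderMean n A F := by
  induction n generalizing A F with
  | zero => rfl
  | succ n ih => simp only [orderMean, ih, ← Finset.mul_sum, mul_div_assoc]

theorem orderMean_sum {ι : Type*} (s : Finset ι) (n : ℕ) (A : Finset V) (F : ι → List V → ℝ) :
    orderMean n A (fun l => ∑ i ∈ s, F i l) = ∑ i ∈ s, orderMean n A (F i) := by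
  classical
  induction s using Finset.induction_on with
  | empty => simpa using orderMean_const_mul n A 0 fun _ => 0
  | insert i s hi ih => simp only [Finset.sum_insert hi, orderMean_add, ih]

theorem orderMean_mono {n : ℕ} {A : Finset V} (hA : A.card = n) {F F' : List V → ℝ}
    (h : ∀ l : List V, l.Nodup → l.toFinset = A → F l ≤ F' l) :
    orderMean n A F ≤ orderMean n A F' := by
  induction n generalizing A F F' with
  | zero => exact h [] (by simp) (by simpa using (Finset.card_eq_zero.1 hA).symm)
  | succ n ih =>
    simp only [orderMean]
    gcongr with i hi
    refine ih (by rw [Finset.card_erase_of_mem hi, hA]; rfl) fun l hl hlA => h _ ?_ ?_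
    · refine List.nodup_cons.2 ⟨fun hil => ?_, hl⟩
      simpa [hlA] using List.mem_toFinset.2 hil
    · rw [List.toFinset_cons, hlA, Finset.insert_erase hi]

theorem orderMean_congr {n : ℕ} {A : Finset V} (hA : A.card = n) {F F' : List V → ℝ}
    (h : ∀ l : List V, l.Nodup → l.toFinset = A → F l = F' l) :
    orderMean n A F = orderMean n A F' :=
  le_antisymm (orderMean_mono hA fun l h1 h2 => (h l h1 h2).le)
    (orderMean_mono hA fun l h1 h2 => (h l h1 h2).ge)

theorem orderMean_const {n : ℕ} {A : Finset V} (hA : A.card = n) (c : ℝ) :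
    orderMean n A (fun _ => c) = c := by
  induction n generalizing A with
  | zero => rfl
  | succ n ih =>
    simp only [orderMean]
    rw [Finset.sum_congr rfl fun i hi => ih (by rw [Finset.card_erase_of_mem hi, hA]; rfl)]
    rw [Finset.sum_const, hA, nsmul_eq_mul]
    push_cast
    field_simp

theorem orderMean_map (σ : Equiv.Perm V) (n : ℕ) (A : Finset V) (F : List V → ℝ) :
    orderMean n A (fun l => F (l.map σ)) = orderMean n (A.map σ.toEmbedding) F := by
  induction n generalizing A F with
  | zero => rfl
  | succ n ih =>
    simp only [orderMean, List.map_cons, Finset.sum_map]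
    congr 1
    refine Finset.sum_congr rfl fun i _ => ?_
    rw [ih (A.erase i) fun l => F (σ i :: l), Finset.map_erase]
    rfl

end RandomOrder

/-! ### The greedy algorithm along an ordering, and its truncated recursion -/

section Greedy

variable {V : Type u} [DecidableEq V] (G : SimpleGraph V) [DecidableRel G.Adj]

/-- The nodes that remain after `i` and its neighbours are deleted from `R`. -/
def remaining (R : Finset V) (i : V) : Finset V := (R.erase i).filter fun j => ¬ G.Adj i j

/-- The greedy algorithm on the remaining nodes `R` that inspects the nodes in the order of `l`. -/
def greedyList : List V → Finset V → Finset V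
  | [], _ => ∅
  | i :: l, R => if i ∈ R then insert i (greedyList l (remaining G R i)) else greedyList l R

theorem remaining_subset_erase (R : Finset V) (i : V) : remaining G R i ⊆ R.erase i :=
  Finset.filter_subset _ _

theorem greedyList_subset (l : List V) (R : Finset V) : greedyList G l R ⊆ R := by
  induction l generalizing R with
  | nil => simp [greedyList]
  | cons i l ih =>
    rw [greedyList]
    split_ifs with h
    · refine Finset.insert_subset h ((ih _).trans ?_)
      exact (remaining_subset_erase G R i).trans (Finset.erase_subset _ _)
    · exact ih R

/-- A node is selected iff none of its neighbours is selected earlier. -/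
theorem mem_greedyList_iff {l : List V} (hl : l.Nodup) {R : Finset V} {v : V} (hv : v ∈ l)
    (hR : v ∈ R) : v ∈ greedyList G l R ↔
      ∀ u, G.Adj v u → l.idxOf u < l.idxOf v → u ∉ greedyList G l R := by
  induction l generalizing R with
  | nil => simp at hv
  | cons i l ih =>
    obtain ⟨hil, hl'⟩ := List.nodup_cons.1 hl
    by_cases hvi : v = i
    · subst hvi
      simp [greedyList, hR]
    have hvl : v ∈ l := by simpa [hvi] using hv
    have hidx (u : V) (hu : u ≠ i) :
        (i :: l).idxOf u < (i :: l).idxOf v ↔ l.idxOf u < l.idxOf v := by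
      rw [List.idxOf_cons_ne _ (Ne.symm hu), List.idxOf_cons_ne _ (Ne.symm hvi)]
      omega
    have hidx' : (i :: l).idxOf i < (i :: l).idxOf v := by
      rw [List.idxOf_cons_ne _ (Ne.symm hvi)]
      simp
    rw [greedyList]
    split_ifs with h
    · by_cases hadj : G.Adj i v
      · have h1 : v ∉ remaining G R i := by simp [remaining, hadj]
        refine iff_of_false ?_ ?_
        · rw [Finset.mem_insert]
          rintro (h2 | h2)
          · exact hvi h2
          · exact h1 (greedyList_subset G _ _ h2)
        · intro h2
          exact h2 i hadj.symm hidx' (Finset.mem_insert_self _ _)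
      · have h1 : v ∈ remaining G R i := by simp [remaining, hadj, hvi, hR]
        rw [Finset.mem_insert, or_iff_right hvi, ih hl' hvl h1]
        refine forall_congr' fun u => imp_congr_right fun hu => ?_
        have hui : u ≠ i := by rintro rfl; exact hadj hu.symm
        rw [hidx u hui, Finset.mem_insert, or_iff_right hui]
    · rw [ih hl' hvl hR]
      refine forall_congr' fun u => imp_congr_right fun hu => ?_
      by_cases hui : u = i
      · subst hui
        exact iff_of_true (fun _ h2 => h (greedyList_subset G _ _ h2))
          (fun _ h2 => h (greedyList_subset G _ _ h2))
      · rw [hidx u hui]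

variable [Fintype V]

/-- The mean of `F` under the law of the greedy algorithm run on `R`. -/
noncomputable def greedyMean (R : Finset V) (F : Finset V → ℝ) : ℝ :=
  ∑ I : Finset V, (greedyFrom G R I).toReal * F I

theorem PMF.sum_toReal_bind {α β : Type*} [Fintype α] [Fintype β] (p : PMF α) (f : α → PMF β)
    (F : β → ℝ) : ∑ b, ((p.bind f) b).toReal * F b =
      ∑ a, (p a).toReal * ∑ b, (f a b).toReal * F b := by
  have (b : β) : ((p.bind f) b).toReal = ∑ a, (p a).toReal * (f a b).toReal := by
    rw [PMF.bind_apply, tsum_fintype, ENNReal.toReal_sum]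
    · simp
    · intro a _
      exact ENNReal.mul_ne_top (p.apply_ne_top a) ((f a).apply_ne_top b)
  simp only [this, Finset.sum_mul, Finset.mul_sum, mul_assoc]
  exact Finset.sum_comm

theorem PMF.sum_toReal_pure {β : Type*} [Fintype β] (b : β) (F : β → ℝ) :
    ∑ c, ((PMF.pure b) c).toReal * F c = F b := by
  classical
  rw [Finset.sum_eq_single b]
  · simp
  · intro c _ hc
    simp [hc]
  · simp

theorem PMF.sum_toReal_map {α β : Type*} [Fintype α] [Fintype β] (p : PMF α) (f : α → β)
    (F : β → ℝ) : ∑ b, ((p.map f) b).toReal * F b = ∑ a, (p a).toReal * F (f a) := by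
  rw [← PMF.bind_pure_comp, PMF.sum_toReal_bind]
  simp only [Function.comp_apply, PMF.sum_toReal_pure]

theorem greedyMean_empty (F : Finset V → ℝ) : greedyMean G ∅ F = F ∅ := by
  rw [greedyMean, greedyFrom]
  simp only [Finset.not_nonempty_empty, dite_false]
  exact PMF.sum_toReal_pure _ _

/-- One step of the algorithm, multiplied out so that it also covers empty `R`. -/
theorem card_mul_greedyMean (R : Finset V) (F : Finset V → ℝ) :
    R.card * greedyMean G R F =
      ∑ i ∈ R, greedyMean G (remaining G R i) fun I => F (insert i I) := by
  rcases R.eq_empty_or_nonempty with rfl | h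
  · simp
  have : Nonempty R := h.to_subtype
  have hc : (R.card : ℝ) ≠ 0 := by simpa using h.ne_empty
  rw [greedyMean, greedyFrom]
  simp only [h, dite_true]
  rw [PMF.sum_toReal_bind, Finset.mul_sum, ← Finset.sum_coe_sort R]
  refine Finset.sum_congr rfl fun i _ => ?_
  rw [PMF.sum_toReal_map, PMF.uniformOfFintype_apply, ← mul_assoc, greedyMean]
  simp [remaining, hc]

/-- Inspecting all nodes in a uniformly random order gives the law of the greedy algorithm. -/
theorem orderMean_greedyList {n : ℕ} {A R : Finset V} (hA : A.card = n) (hR : R ⊆ A)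
    (F : Finset V → ℝ) : orderMean n A (fun l => F (greedyList G l R)) = greedyMean G R F := by
  induction n generalizing A R F with
  | zero =>
    obtain rfl : A = ∅ := Finset.card_eq_zero.1 hA
    obtain rfl : R = ∅ := Finset.subset_empty.1 hR
    rw [greedyMean_empty]
    rfl
  | succ n ih =>
    have hn : ((n : ℝ) + 1) ≠ 0 := by positivity
    -- A first node in `R` performs one greedy step; a first node outside `R` is skipped and leaves
    -- the mean unchanged. The two groups contribute `R.card` and `A.card - R.card` times
    -- `greedyMean G R F`.
    rw [orderMean, div_eq_iff hn, ← Finset.sum_sdiff hR]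
    have hcard : ∀ i ∈ A, (A.erase i).card = n := fun i hi => by
      rw [Finset.card_erase_of_mem hi, hA]; rfl
    have h1 : ∀ i ∈ R, orderMean n (A.erase i) (fun l => F (greedyList G (i :: l) R)) =
        greedyMean G (remaining G R i) fun I => F (insert i I) := fun i hi => by
      rw [← ih (hcard i (hR hi)) ((remaining_subset_erase G R i).trans
        (Finset.erase_subset_erase i hR))]
      simp only [greedyList, hi, if_true]
    have h2 : ∀ i ∈ A \ R, orderMean n (A.erase i) (fun l => F (greedyList G (i :: l) R)) =
        greedyMean G R F := fun i hi => by
      obtain ⟨hi, hiR⟩ := Finset.mem_sdiff.1 hi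
      rw [← ih (hcard i hi) (Finset.subset_erase.2 ⟨hR, hiR⟩)]
      simp only [greedyList, hiR, if_false]
    rw [Finset.sum_congr rfl h1, Finset.sum_congr rfl h2, ← card_mul_greedyMean,
      Finset.sum_const, Finset.card_sdiff_of_subset hR, nsmul_eq_mul,
      Nat.cast_sub (Finset.card_le_card hR), hA]
    push_cast
    ring

theorem expectedGreedyRatio_eq : expectedGreedyRatio G =
    (∑ v, orderMean (Fintype.card V) Finset.univ
      fun l => if v ∈ greedyList G l Finset.univ then (1 : ℝ) else 0) / Fintype.card V := by
  have h (v : V) := orderMean_greedyList G (Finset.card_univ (α := V)) (Finset.Subset.refl _)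
    fun I => if v ∈ I then (1 : ℝ) else 0
  simp only [h, greedyMean]
  rw [Finset.sum_comm, expectedGreedyRatio, Finset.sum_div]
  refine Finset.sum_congr rfl fun I _ => ?_
  rw [← Finset.mul_sum, mul_div_assoc, greedyIndepSet]
  simp

/-- The depth `k` truncation of the recursion that decides whether `v` is selected when the nodes
are inspected in the order of their weights `x`; the node `p` is ignored. -/
noncomputable def truncatedGreedy : ℕ → V → V → (V → ℝ) → ℝ
  | 0, _, _, _ => 0
  | k + 1, p, v, x => ∏ u ∈ (G.neighborFinset v).erase p,
      (1 - if x u < x v then truncatedGreedy k v u x else 0)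

theorem truncatedGreedy_mem_Icc (k : ℕ) (p v : V) (x : V → ℝ) :
    truncatedGreedy G k p v x ∈ Set.Icc (0 : ℝ) 1 := by
  induction k generalizing p v with
  | zero => simp [truncatedGreedy]
  | succ k ih =>
    rw [truncatedGreedy]
    have h (u : V) : 1 - (if x u < x v then truncatedGreedy G k v u x else 0) ∈
        Set.Icc (0 : ℝ) 1 := by
      split_ifs
      · exact ⟨by linarith [(ih v u).2], by linarith [(ih v u).1]⟩
      · simp
    exact ⟨Finset.prod_nonneg fun u _ => (h u).1,
      Finset.prod_le_one (fun u _ => (h u).1) fun u _ => (h u).2⟩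

theorem truncatedGreedy_congr (k : ℕ) (p v : V) {x y : V → ℝ} (h : ∀ i j, x i < x j ↔ y i < y j) :
    truncatedGreedy G k p v x = truncatedGreedy G k p v y := by
  induction k generalizing p v with
  | zero => rfl
  | succ k ih => simp only [truncatedGreedy, ih, h]

/-- The recursion only descends to smaller weights, so the ignored parent `p` would contribute the
factor 1. -/
theorem truncatedGreedy_succ_of_lt (k : ℕ) {p v : V} {x : V → ℝ} (h : x v < x p) :
    truncatedGreedy G (k + 1) p v x = ∏ u ∈ G.neighborFinset v,
      (1 - if x u < x v then truncatedGreedy G k v u x else 0) := by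
  rw [truncatedGreedy]
  refine Finset.prod_subset (Finset.erase_subset _ _) fun u hu hu' => ?_
  obtain rfl : u = p := by
    by_contra hne
    exact hu' (Finset.mem_erase.2 ⟨hne, hu⟩)
  simp [h.not_gt]

/-- The choice `p = v` encodes a root: no neighbour is ignored. -/
theorem truncatedGreedy_succ_self (k : ℕ) (v : V) (x : V → ℝ) :
    truncatedGreedy G (k + 1) v v x = ∏ u ∈ G.neighborFinset v,
      (1 - if x u < x v then truncatedGreedy G k v u x else 0) := by
  rw [truncatedGreedy, Finset.erase_eq_of_notMem (by simp)]

theorem indicator_greedyList_eq_prod {l : List V} (hl : l.Nodup) (hlV : l.toFinset = Finset.univ)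
    (v : V) : (if v ∈ greedyList G l Finset.univ then (1 : ℝ) else 0) =
      ∏ u ∈ G.neighborFinset v, (1 - if (l.idxOf u : ℝ) < l.idxOf v then
        (if u ∈ greedyList G l Finset.univ then (1 : ℝ) else 0) else 0) := by
  have hv : v ∈ l := by rw [← List.mem_toFinset, hlV]; exact Finset.mem_univ v
  have h := mem_greedyList_iff G hl hv (Finset.mem_univ v)
  split_ifs with hm
  · refine (Finset.prod_eq_one fun u hu => ?_).symm
    split_ifs with h1 h2
    · exact absurd h2 (h.1 hm u (by simpa using hu) (by exact_mod_cast h1))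
    · simp
    · simp
  · rw [h] at hm
    push Not at hm
    obtain ⟨u, h1, h2, h3⟩ := hm
    refine (Finset.prod_eq_zero (i := u) (by simpa using h1) ?_).symm
    rw [if_pos (by exact_mod_cast h2), if_pos h3, sub_self]

theorem prod_one_sub_ite_anti {ι : Type*} (s : Finset ι) (P : ι → Prop) [DecidablePred P]
    {a b : ι → ℝ} (hab : ∀ i ∈ s, P i → a i ≤ b i) (hb : ∀ i, b i ≤ 1) :
    ∏ i ∈ s, (1 - if P i then b i else 0) ≤ ∏ i ∈ s, (1 - if P i then a i else 0) := by
  refine Finset.prod_le_prod (fun i _ => ?_) fun i hi => ?_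
  · split_ifs
    · linarith [hb i]
    · norm_num
  · split_ifs with h
    · linarith [hab i hi h]
    · exact le_rfl

/-- The value 0 at depth 0 is a lower bound, and `prod_one_sub_ite_anti` reverses the inequality at
each level. The condition on `p` ensures that ignoring `p` drops no relevant factor. -/
theorem indicator_greedyList_bounds {l : List V} (hl : l.Nodup)
    (hlV : l.toFinset = Finset.univ) (k : ℕ) {p v : V}
    (hpv : p = v ∨ (l.idxOf v : ℝ) < l.idxOf p) :
    (Even k → truncatedGreedy G k p v (fun w => l.idxOf w) ≤
      if v ∈ greedyList G l Finset.univ then (1 : ℝ) else 0) ∧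
    (¬ Even k → (if v ∈ greedyList G l Finset.univ then (1 : ℝ) else 0) ≤
      truncatedGreedy G k p v fun w => l.idxOf w) := by
  induction k generalizing p v with
  | zero =>
    refine ⟨fun _ => ?_, fun h => absurd Even.zero h⟩
    rw [truncatedGreedy]
    split_ifs <;> norm_num
  | succ k ih =>
    have h1 : truncatedGreedy G (k + 1) p v (fun w => l.idxOf w) = ∏ u ∈ G.neighborFinset v,
        (1 - if (l.idxOf u : ℝ) < l.idxOf v then
          truncatedGreedy G k v u (fun w => l.idxOf w) else 0) := by
      rcases hpv with rfl | hpv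
      · exact truncatedGreedy_succ_self G k p _
      · exact truncatedGreedy_succ_of_lt G k hpv
    rw [h1, indicator_greedyList_eq_prod G hl hlV v, Nat.even_add_one, not_not]
    constructor <;> intro hk
    · refine prod_one_sub_ite_anti _ _ (fun u _ hu => (ih (Or.inr hu)).2 hk) fun u => ?_
      exact (truncatedGreedy_mem_Icc G k v u _).2
    · refine prod_one_sub_ite_anti _ _ (fun u _ hu => (ih (Or.inr hu)).1 hk) fun u => ?_
      split_ifs <;> norm_num

end Greedy

/-! ### Independence and conditioning in product measures -/

open MeasureTheory

section ProductMeasure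

variable {ι : Type*} [Fintype ι] [DecidableEq ι] {ν : Measure ℝ} [IsProbabilityMeasure ν]

/-- Taking the coordinates outside `s` from an independent copy does not change the law; this makes
functions of disjoint sets of coordinates independent in `integral_mul_of_dependsOn`. -/
theorem measurePreserving_piecewise_pi (s : Finset ι) :
    MeasurePreserving (fun q : (ι → ℝ) × (ι → ℝ) => s.piecewise q.1 q.2)
      ((Measure.pi fun _ : ι => ν).prod (Measure.pi fun _ : ι => ν))
      (Measure.pi fun _ : ι => ν) := by
  have hm : Measurable fun q : (ι → ℝ) × (ι → ℝ) => s.piecewise q.1 q.2 := by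
    refine measurable_pi_lambda _ fun i => ?_
    by_cases hi : i ∈ s
    · simp only [hi, Finset.piecewise_eq_of_mem]
      fun_prop
    · simp only [hi, not_false_eq_true, Finset.piecewise_eq_of_notMem]
      fun_prop
  refine ⟨hm, (Measure.pi_eq fun A hA => ?_).symm⟩
  rw [Measure.map_apply hm (MeasurableSet.univ_pi hA)]
  have h : (fun q : (ι → ℝ) × (ι → ℝ) => s.piecewise q.1 q.2) ⁻¹' Set.univ.pi A =
      (Set.univ.pi (s.piecewise A fun _ => Set.univ)) ×ˢ
        (Set.univ.pi (s.piecewise (fun _ => Set.univ) A)) := by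
    ext q
    simp only [Set.mem_preimage, Set.mem_univ_pi, Set.mem_prod, ← forall_and]
    refine forall_congr' fun i => ?_
    by_cases hi : i ∈ s <;> simp [hi]
  rw [h, Measure.prod_prod, Measure.pi_pi, Measure.pi_pi, ← Finset.prod_mul_distrib]
  refine Finset.prod_congr rfl fun i _ => ?_
  by_cases hi : i ∈ s <;> simp [hi]

theorem measurePreserving_update_pi (i : ι) :
    MeasurePreserving (fun q : ℝ × (ι → ℝ) => Function.update q.2 i q.1)
      (ν.prod (Measure.pi fun _ : ι => ν)) (Measure.pi fun _ : ι => ν) := by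
  have hm : Measurable fun q : ℝ × (ι → ℝ) => Function.update q.2 i q.1 := by
    refine measurable_pi_lambda _ fun j => ?_
    by_cases hj : j = i
    · subst hj
      simpa using measurable_fst
    · simp only [Function.update_of_ne hj]
      fun_prop
  refine ⟨hm, (Measure.pi_eq fun A hA => ?_).symm⟩
  rw [Measure.map_apply hm (MeasurableSet.univ_pi hA)]
  have h : (fun q : ℝ × (ι → ℝ) => Function.update q.2 i q.1) ⁻¹' Set.univ.pi A =
      A i ×ˢ (Set.univ.pi (Function.update A i Set.univ)) := by
    ext q
    simp only [Set.mem_preimage, Set.mem_univ_pi, Set.mem_prod]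
    constructor
    · refine fun h => ⟨by simpa using h i, fun j => ?_⟩
      by_cases hj : j = i
      · subst hj
        simp
      · simpa [hj] using h j
    · rintro ⟨h1, h2⟩ j
      by_cases hj : j = i
      · subst hj
        simpa using h1
      · simpa [hj] using h2 j
  rw [h, Measure.prod_prod, Measure.pi_pi, ← Finset.mul_prod_erase _ _ (Finset.mem_univ i),
    ← Finset.mul_prod_erase _ (fun j => ν (A j)) (Finset.mem_univ i)]
  simp only [Function.update_self, measure_univ, one_mul]
  congr 1
  refine Finset.prod_congr rfl fun j hj => ?_
  rw [Function.update_of_ne (Finset.ne_of_mem_erase hj)]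

theorem integral_pi_eq_integral_update (i : ι) {f : (ι → ℝ) → ℝ}
    (hf : Integrable f (Measure.pi fun _ : ι => ν)) :
    ∫ x, f x ∂(Measure.pi fun _ : ι => ν) =
      ∫ s, ∫ x, f (Function.update x i s) ∂(Measure.pi fun _ : ι => ν) ∂ν := by
  have hp := measurePreserving_update_pi (ν := ν) i
  have h1 : AEStronglyMeasurable f (Measure.map (fun q : ℝ × (ι → ℝ) => Function.update q.2 i q.1)
      (ν.prod (Measure.pi fun _ : ι => ν))) := by
    rw [hp.map_eq]; exact hf.aestronglyMeasurable
  calc ∫ x, f x ∂(Measure.pi fun _ : ι => ν)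
      = ∫ q : ℝ × (ι → ℝ), f (Function.update q.2 i q.1)
          ∂(ν.prod (Measure.pi fun _ : ι => ν)) := by
        rw [← integral_map hp.aemeasurable h1, hp.map_eq]
    _ = _ := integral_prod _ (hp.integrable_comp_of_integrable hf)

theorem integral_mul_of_dependsOn (s : Finset ι) {f g : (ι → ℝ) → ℝ} (hf : Measurable f)
    (hg : Measurable g) (hfs : DependsOn f (s : Set ι)) (hgs : DependsOn g (s : Set ι)ᶜ) :
    ∫ x, f x * g x ∂(Measure.pi fun _ : ι => ν) =
      (∫ x, f x ∂(Measure.pi fun _ : ι => ν)) * ∫ x, g x ∂(Measure.pi fun _ : ι => ν) := by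
  have hp := measurePreserving_piecewise_pi (ν := ν) s
  have h0 : Measurable fun x => f x * g x := hf.mul hg
  have h := integral_map hp.aemeasurable
    (h0.aestronglyMeasurable (μ := Measure.map _ _))
  rw [hp.map_eq] at h
  rw [← integral_prod_mul, h]
  refine integral_congr_ae (Filter.Eventually.of_forall fun q => ?_)
  have h1 : f (s.piecewise q.1 q.2) = f q.1 := hfs fun i hi => by
    simp [Finset.mem_coe.1 hi]
  have h2 : g (s.piecewise q.1 q.2) = g q.2 := hgs fun i hi => by
    have : i ∉ s := fun h => hi (Finset.mem_coe.2 h)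
    simp [this]
  simp only [h1, h2]

theorem integral_prod_of_dependsOn {κ : Type*} (U : Finset κ) {f : κ → (ι → ℝ) → ℝ}
    {B : κ → Set ι} (hf : ∀ u ∈ U, Measurable (f u)) (hd : ∀ u ∈ U, DependsOn (f u) (B u))
    (hB : (U : Set κ).PairwiseDisjoint B) :
    ∫ x, ∏ u ∈ U, f u x ∂(Measure.pi fun _ : ι => ν) =
      ∏ u ∈ U, ∫ x, f u x ∂(Measure.pi fun _ : ι => ν) := by
  classical
  induction U using Finset.induction_on with
  | empty => simp
  | insert a U ha ih =>
    have hfU := fun u hu => hf u (Finset.mem_insert_of_mem (a := u) hu)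
    have hdU := fun u hu => hd u (Finset.mem_insert_of_mem (a := u) hu)
    simp only [Finset.prod_insert ha]
    rw [← ih hfU hdU (hB.subset (by simp))]
    refine integral_mul_of_dependsOn (B a).toFinset (hf a (Finset.mem_insert_self _ _))
      (Finset.measurable_fun_prod _ hfU) ?_ ?_
    · simpa using hd a (Finset.mem_insert_self _ _)
    · intro x y hxy
      refine Finset.prod_congr rfl fun u hu => hdU u hu fun i hi => hxy i ?_
      have hau : a ≠ u := by rintro rfl; exact ha hu
      have := hB (Finset.mem_coe.2 (Finset.mem_insert_self a U))
        (Finset.mem_coe.2 (Finset.mem_insert_of_mem hu)) hau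
      simpa using fun h => Set.disjoint_left.1 this h hi

theorem ae_injective_pi [NullSingletonClass ν] :
    ∀ᵐ x ∂(Measure.pi fun _ : ι => ν), Function.Injective x := by
  have h (i j : ι) (hij : i ≠ j) : ∀ᵐ x ∂(Measure.pi fun _ : ι => ν), x i ≠ x j := by
    have hp := measurePreserving_update_pi (ν := ν) i
    have hms : MeasurableSet {x : ι → ℝ | x i ≠ x j} :=
      (measurableSet_eq_fun (measurable_pi_apply i) (measurable_pi_apply j)).compl
    rw [← hp.map_eq, ae_map_iff hp.aemeasurable hms]
    have hms' : MeasurableSet {q : ℝ × (ι → ℝ) |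
        Function.update q.2 i q.1 i ≠ Function.update q.2 i q.1 j} := hp.measurable hms
    rw [Measure.ae_prod_iff_ae_ae hms']
    refine Filter.Eventually.of_forall fun s => ?_
    have := Measure.ae_eval_ne (μ := fun _ : ι => ν) j s
    filter_upwards [this] with x hx
    simpa [hij.symm] using hx.symm
  have h' : ∀ᵐ x ∂(Measure.pi fun _ : ι => ν), ∀ i j, i ≠ j → x i ≠ x j := by
    simp only [ae_all_iff]
    exact h
  filter_upwards [h'] with x hx i j hij
  by_contra hne
  exact hx i j hne hij

end ProductMeasure

/-! ### From random orderings to independent weights -/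

section Exchangeability

theorem List.idxOf_map_equiv {α β : Type*} [DecidableEq α] [DecidableEq β] (e : α ≃ β)
    (l : List α) (a : α) : (l.map e).idxOf (e a) = l.idxOf a := by
  induction l with
  | nil => rfl
  | cons b l ih =>
    by_cases h : b = a
    · simp [h]
    · rw [List.map_cons, List.idxOf_cons_ne _ (e.injective.ne h), List.idxOf_cons_ne _ h, ih]

variable {V : Type*} [Fintype V]

theorem exists_perm_order_iff {x y : V → ℝ} (hx : Function.Injective x)
    (hy : Function.Injective y) :
    ∃ τ : Equiv.Perm V, ∀ i j, x i < x j ↔ y (τ i) < y (τ j) := by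
  classical
  have key (z : V → ℝ) (hz : Function.Injective z) :
      ∃ e : V ≃ Fin (Fintype.card V), ∀ i j, z i < z j ↔ e i < e j := by
    let _ : LinearOrder V := LinearOrder.lift' z hz
    refine ⟨(Fintype.orderIsoFinOfCardEq V rfl).symm.toEquiv, fun i j => ?_⟩
    exact ((Fintype.orderIsoFinOfCardEq V rfl).symm.lt_iff_lt (x := i) (y := j)).symm
  obtain ⟨e, he⟩ := key x hx
  obtain ⟨e', he'⟩ := key y hy
  exact ⟨e.trans e'.symm, fun i j => by simp [he, he']⟩

variable {f : (V → ℝ) → ℝ}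

/-- Two injective weightings have the same order up to a relabelling, which the sum over all
permutations absorbs. -/
theorem sum_perm_eq_of_order_invariant [DecidableEq V]
    (hf : ∀ x y : V → ℝ, (∀ i j, x i < x j ↔ y i < y j) → f x = f y) {x y : V → ℝ}
    (hx : Function.Injective x) (hy : Function.Injective y) :
    ∑ σ : Equiv.Perm V, f (x ∘ σ) = ∑ σ : Equiv.Perm V, f (y ∘ σ) := by
  obtain ⟨τ, hτ⟩ := exists_perm_order_iff hx hy
  rw [← Equiv.sum_comp (Equiv.mulLeft τ) fun σ => f (y ∘ σ)]
  refine Finset.sum_congr rfl fun σ _ => hf _ _ fun i j => ?_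
  simp [hτ]

/-- The mean of a functional of the order of the nodes over a uniformly random ordering is its mean
over independent weights with a common atomless law. -/
theorem orderMean_eq_integral [DecidableEq V] {ν : Measure ℝ} [IsProbabilityMeasure ν] [NullSingletonClass ν]
    (hf : ∀ x y : V → ℝ, (∀ i j, x i < x j ↔ y i < y j) → f x = f y)
    (hi : Integrable f (Measure.pi fun _ : V => ν)) :
    orderMean (Fintype.card V) Finset.univ (fun l => f fun v => l.idxOf v) =
      ∫ x, f x ∂(Measure.pi fun _ : V => ν) := by
  -- Both means are invariant under relabelling, so each can be averaged over all permutations. The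
  -- averaged integrand is almost surely the constant given by any injective reference weighting
  -- `x₀`.
  obtain ⟨x₀, hx₀⟩ : ∃ x : V → ℝ, Function.Injective x :=
    ⟨fun v => ((Fintype.equivFin V v : ℕ) : ℝ), fun a b h => by
      simpa [Fin.val_inj] using h⟩
  have hN : (Fintype.card (Equiv.Perm V) : ℝ) ≠ 0 := by simp [Fintype.card_ne_zero]
  have h1 : (Fintype.card (Equiv.Perm V) : ℝ) *
      orderMean (Fintype.card V) Finset.univ (fun l => f fun v => l.idxOf v) =
        ∑ σ : Equiv.Perm V, f (x₀ ∘ σ) := by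
    have hσ (σ : Equiv.Perm V) :
        orderMean (Fintype.card V) Finset.univ (fun l => f fun v => l.idxOf v) =
          orderMean (Fintype.card V) Finset.univ
            (fun l => f fun v => (l.map (σ⁻¹ : Equiv.Perm V)).idxOf v) := by
      rw [orderMean_map σ⁻¹ _ _ fun l => f fun v => l.idxOf v]
      simp
    rw [← nsmul_eq_mul, ← Finset.card_univ, ← Finset.sum_const, Finset.sum_congr rfl
      fun σ _ => hσ σ, ← orderMean_sum]
    rw [← orderMean_const (Finset.card_univ (α := V)) (∑ σ : Equiv.Perm V, f (x₀ ∘ σ))]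
    refine orderMean_congr (Finset.card_univ (α := V)) fun l hl hlV => ?_
    have hinj : Function.Injective fun v => (l.idxOf v : ℝ) := by
      intro a b hab
      have ha : a ∈ l := by rw [← List.mem_toFinset, hlV]; exact Finset.mem_univ a
      exact (List.idxOf_inj ha).1 (Nat.cast_injective hab)
    rw [sum_perm_eq_of_order_invariant hf hx₀ hinj]
    refine Finset.sum_congr rfl fun σ _ => congrArg f (funext fun v => ?_)
    rw [Function.comp_apply, ← List.idxOf_map_equiv (σ⁻¹ : Equiv.Perm V) l (σ v)]
    simp
  have h2 : (Fintype.card (Equiv.Perm V) : ℝ) * ∫ x, f x ∂(Measure.pi fun _ : V => ν) =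
      ∑ σ : Equiv.Perm V, f (x₀ ∘ σ) := by
    have hp (σ : Equiv.Perm V) : MeasurePreserving (fun x : V → ℝ => x ∘ σ)
        (Measure.pi fun _ : V => ν) (Measure.pi fun _ : V => ν) := by
      have := measurePreserving_piCongrLeft (fun _ : V => ν) σ⁻¹
      convert this using 1
      ext x v
      have := MeasurableEquiv.piCongrLeft_apply_apply σ⁻¹ (β := fun _ : V => ℝ) x (σ v)
      simpa using this.symm
    have hσ (σ : Equiv.Perm V) : ∫ x, f x ∂(Measure.pi fun _ : V => ν) =
        ∫ x, f (x ∘ σ) ∂(Measure.pi fun _ : V => ν) := by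
      have h3 : AEStronglyMeasurable f (Measure.map (fun x : V → ℝ => x ∘ σ)
          (Measure.pi fun _ : V => ν)) := by
        rw [(hp σ).map_eq]; exact hi.aestronglyMeasurable
      rw [← integral_map (hp σ).aemeasurable h3, (hp σ).map_eq]
    rw [← nsmul_eq_mul, ← Finset.card_univ, ← Finset.sum_const, Finset.sum_congr rfl
      fun σ _ => hσ σ, ← integral_finsetSum (f := fun (σ : Equiv.Perm V) (x : V → ℝ) => f (x ∘ σ)) _
        fun σ _ => (hp σ).integrable_comp_of_integrable hi]
    have h4 : (fun x : V → ℝ => ∑ σ : Equiv.Perm V, f (x ∘ σ)) =ᵐ[Measure.pi fun _ : V => ν]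
        fun _ => ∑ σ : Equiv.Perm V, f (x₀ ∘ σ) := by
      filter_upwards [ae_injective_pi (ι := V) (ν := ν)] with x hx
      exact sum_perm_eq_of_order_invariant hf hx hx₀
    rw [integral_congr_ae h4]
    simp
  exact mul_left_cancel₀ hN (h1.trans h2.symm)

end Exchangeability

/-! ### Disjointness of branches below the girth -/

section Reach

variable {V : Type*} {G : SimpleGraph V}

/-- The nodes at distance less than `k` from `v` along non-backtracking walks that do not start with
the edge from `v` to `p`. -/
def reach (G : SimpleGraph V) (k : ℕ) (p v : V) : Set V :=
  {w | ∃ q : G.Walk v w, q.length < k ∧ (s(p, v) :: q.edges).IsChain (· ≠ ·)}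

theorem self_mem_reach (k : ℕ) (p v : V) : v ∈ reach G (k + 1) p v :=
  ⟨.nil, by simp, by simp⟩

theorem reach_subset_reach_succ (k : ℕ) {p v u : V} (h : G.Adj v u) (hu : u ≠ p) :
    reach G k v u ⊆ reach G (k + 1) p v := by
  rintro w ⟨q, hq, hc⟩
  refine ⟨.cons h q, by simpa using hq, ?_⟩
  rw [SimpleGraph.Walk.edges_cons, List.isChain_cons_cons]
  refine ⟨fun he => ?_, hc⟩
  rw [Sym2.eq_iff] at he
  rcases he with ⟨h1, h2⟩ | ⟨h1, -⟩
  · exact h.ne h2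
  · exact hu h1.symm

/-- Otherwise the edge from `v` to `u` would extend to a closed non-backtracking walk of positive
length at most `k`, which cannot be a path. -/
theorem notMem_reach {k : ℕ} (hk : ((2 * k : ℕ) : ℕ∞) < G.egirth) {v u : V} (h : G.Adj v u) :
    v ∉ reach G k v u := by
  rintro ⟨q, hq, hc⟩
  have h1 := (SimpleGraph.Walk.cons h q).isPath_of_isChain_of_length_lt_egirth
    (by simpa using hc) (lt_of_le_of_lt (by
      rw [SimpleGraph.Walk.length_cons]; exact_mod_cast (by omega)) hk)
  simp [SimpleGraph.Walk.isPath_iff_nil] at h1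

/-- Two walks to a common node `w`, each extended to start at `v`, glue to a closed walk at `w` of
length at most `2 * k`. It does not backtrack at `v` because `u ≠ u'`, so it would be a path. -/
theorem disjoint_reach {k : ℕ} (hk : ((2 * k : ℕ) : ℕ∞) < G.egirth) {v u u' : V} (h : G.Adj v u)
    (h' : G.Adj v u') (hne : u ≠ u') : Disjoint (reach G k v u) (reach G k v u') := by
  rw [Set.disjoint_left]
  rintro w ⟨q, hq, hc⟩ ⟨q', hq', hc'⟩
  have h1 := ((SimpleGraph.Walk.cons h q).reverse.append
    (SimpleGraph.Walk.cons h' q')).isPath_of_isChain_of_length_lt_egirth (by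
      rw [SimpleGraph.Walk.edges_append, List.isChain_append]
      refine ⟨?_, by simpa using hc', ?_⟩
      · rw [SimpleGraph.Walk.edges_reverse, List.isChain_reverse, SimpleGraph.Walk.edges_cons]
        exact hc.imp fun _ _ h => h.symm
      · intro e he e' he'
        simp only [SimpleGraph.Walk.edges_reverse, SimpleGraph.Walk.edges_cons,
          List.getLast?_reverse, List.head?_cons, Option.mem_some_iff] at he he'
        rw [← he, ← he']
        intro h2
        rw [Sym2.eq_iff] at h2
        rcases h2 with ⟨-, h2⟩ | ⟨h2, -⟩
        · exact hne h2
        · exact h'.ne h2)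
    (lt_of_le_of_lt (by
      simp only [SimpleGraph.Walk.length_append, SimpleGraph.Walk.length_reverse,
        SimpleGraph.Walk.length_cons]
      exact_mod_cast (by omega)) hk)
  simp [SimpleGraph.Walk.isPath_iff_nil, ← SimpleGraph.Walk.length_eq_zero_iff] at h1

end Reach

/-! ### The mean of the truncated recursion is that of the tree -/

/-- The probability that the root of an infinite rooted tree in which every node has `d` children
is selected with weight less than `t`, by the recursion truncated at depth `k`. -/
noncomputable def treeProb (d : ℕ) : ℕ → ℝ → ℝ
  | 0, _ => 0
  | k + 1, t => ∫ s in (0 : ℝ)..t, (1 - treeProb d k s) ^ d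

/-- The uniform law on the unit interval. -/
noncomputable abbrev uniformLaw : Measure ℝ := volume.restrict (Set.Icc 0 1)

instance : IsProbabilityMeasure uniformLaw := ⟨by simp⟩

theorem integral_uniformLaw_ite_lt {t : ℝ} (ht : t ∈ Set.Icc (0 : ℝ) 1) (h : ℝ → ℝ) :
    ∫ s, (if s < t then h s else 0) ∂uniformLaw = ∫ s in (0 : ℝ)..t, h s := by
  have h1 : (fun s => if s < t then h s else 0) = (Set.Iio t).indicator h := by
    ext s
    simp [Set.indicator]
  have h2 : Set.Icc 0 1 ∩ Set.Iio t = Set.Ico 0 t := by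
    ext s
    simp only [Set.mem_inter_iff, Set.mem_Icc, Set.mem_Iio, Set.mem_Ico]
    exact ⟨fun h => ⟨h.1.1, h.2⟩, fun h => ⟨⟨h.1, h.2.le.trans ht.2⟩, h.2⟩⟩
  rw [h1, setIntegral_indicator measurableSet_Iio, h2, integral_Ico_eq_integral_Ioo,
    ← integral_Ioc_eq_integral_Ioo, intervalIntegral.integral_of_le ht.1]

section LocalRecursion

variable {V : Type u} [DecidableEq V] [Fintype V] (G : SimpleGraph V) [DecidableRel G.Adj]

theorem measurable_truncatedGreedy (k : ℕ) (p v : V) : Measurable (truncatedGreedy G k p v) := by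
  induction k generalizing p v with
  | zero => exact measurable_const
  | succ k ih =>
    refine Finset.measurable_fun_prod _ fun u _ => measurable_const.sub ?_
    exact Measurable.ite (measurableSet_lt (measurable_pi_apply u) (measurable_pi_apply v))
      (ih v u) measurable_const

theorem measurable_ite_truncatedGreedy (k : ℕ) (p v : V) (s : ℝ) :
    Measurable fun x : V → ℝ => if x v < s then truncatedGreedy G k p v x else 0 :=
  Measurable.ite (measurableSet_lt (measurable_pi_apply v) measurable_const)
    (measurable_truncatedGreedy G k p v) measurable_const

theorem integrable_truncatedGreedy (k : ℕ) (p v : V) (μ : Measure (V → ℝ)) [IsFiniteMeasure μ] :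
    Integrable (truncatedGreedy G k p v) μ := by
  refine Integrable.of_bound (measurable_truncatedGreedy G k p v).aestronglyMeasurable 1
    (Filter.Eventually.of_forall fun x => ?_)
  have := truncatedGreedy_mem_Icc G k p v x
  rw [Real.norm_eq_abs, abs_of_nonneg this.1]
  exact this.2

theorem integrable_ite_truncatedGreedy (k : ℕ) (p v : V) (s : ℝ) (μ : Measure (V → ℝ))
    [IsFiniteMeasure μ] :
    Integrable (fun x : V → ℝ => if x v < s then truncatedGreedy G k p v x else 0) μ := by
  refine Integrable.of_bound (measurable_ite_truncatedGreedy G k p v s).aestronglyMeasurable 1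
    (Filter.Eventually.of_forall fun x => ?_)
  have := truncatedGreedy_mem_Icc G k p v x
  split_ifs
  · rw [Real.norm_eq_abs, abs_of_nonneg this.1]
    exact this.2
  · simp

theorem dependsOn_truncatedGreedy (k : ℕ) (p v : V) :
    DependsOn (truncatedGreedy G k p v) (reach G k p v) := by
  induction k generalizing p v with
  | zero => exact fun _ _ _ => rfl
  | succ k ih =>
    intro x y hxy
    refine Finset.prod_congr rfl fun u hu => ?_
    obtain ⟨hup, hu⟩ := Finset.mem_erase.1 hu
    have hsub := reach_subset_reach_succ k ((G.mem_neighborFinset v u).1 hu) hup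
    have h1 : truncatedGreedy G k v u x = truncatedGreedy G k v u y :=
      ih v u fun i hi => hxy i (hsub hi)
    -- At depth 1 the weight of `u` lies outside the controlled set, but the comparison with it is
    -- irrelevant since both branches are 0.
    cases k with
    | zero => simp [truncatedGreedy]
    | succ k => rw [h1, hxy v (self_mem_reach _ p v), hxy u (hsub (self_mem_reach _ v u))]

theorem dependsOn_ite_truncatedGreedy (k : ℕ) (p v : V) (s : ℝ) :
    DependsOn (fun x : V → ℝ => if x v < s then truncatedGreedy G k p v x else 0)
      (reach G k p v) := by
  intro x y hxy
  cases k with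
  | zero => simp [truncatedGreedy]
  | succ k =>
    simp only [dependsOn_truncatedGreedy G (k + 1) p v hxy, hxy v (self_mem_reach _ p v)]

/-- Once the weight of `v` is fixed to `s`, the factors of the neighbours depend on disjoint sets of
weights, none containing `v`, so the mean of the product factorises. -/
theorem integral_truncatedGreedy_update {k : ℕ} (hk : ((2 * k : ℕ) : ℕ∞) < G.egirth) (p v : V)
    {s c : ℝ} (hc : ∀ u ∈ (G.neighborFinset v).erase p,
      ∫ x, (if x u < s then truncatedGreedy G k v u x else 0)
        ∂(Measure.pi fun _ : V => uniformLaw) = c) :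
    ∫ x, truncatedGreedy G (k + 1) p v (Function.update x v s)
      ∂(Measure.pi fun _ : V => uniformLaw) = (1 - c) ^ ((G.neighborFinset v).erase p).card := by
  have hadj : ∀ u ∈ (G.neighborFinset v).erase p, G.Adj v u := fun u hu =>
    (G.mem_neighborFinset v u).1 (Finset.mem_of_mem_erase hu)
  have h1 (x : V → ℝ) : truncatedGreedy G (k + 1) p v (Function.update x v s) =
      ∏ u ∈ (G.neighborFinset v).erase p,
        (1 - if x u < s then truncatedGreedy G k v u x else 0) := by
    refine Finset.prod_congr rfl fun u hu => ?_
    rw [Function.update_self, Function.update_of_ne (hadj u hu).ne']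
    have : truncatedGreedy G k v u (Function.update x v s) = truncatedGreedy G k v u x := by
      refine dependsOn_truncatedGreedy G k v u fun i hi => Function.update_of_ne ?_ _ _
      rintro rfl
      exact notMem_reach hk (hadj u hu) hi
    rw [this]
  simp only [h1]
  rw [integral_prod_of_dependsOn (B := fun u => reach G k v u)
    (f := fun u x => 1 - if x u < s then truncatedGreedy G k v u x else 0)]
  · rw [← Finset.prod_const]
    refine Finset.prod_congr rfl fun u hu => ?_
    rw [integral_sub (integrable_const 1) (integrable_ite_truncatedGreedy G k v u s _), hc u hu]
    simp
  · exact fun u _ => measurable_const.sub (measurable_ite_truncatedGreedy G k v u s)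
  · intro u _ x y hxy
    exact congrArg (1 - ·) (dependsOn_ite_truncatedGreedy G k v u s hxy)
  · intro u hu u' hu' hne
    exact disjoint_reach hk (hadj u hu) (hadj u' hu') hne

/-- Conditioning on the weight of `v` leaves `r - 1` independent branches, since the parent `p` is
one of the `r` neighbours. Only nodes at distance at most `k - 1` from `v` matter, whence the bound
on the girth; depth 0 is trivial. -/
theorem integral_ite_truncatedGreedy {r : ℕ} (hr : G.IsRegularOfDegree r) (k : ℕ)
    (hk : ((2 * (k - 1) : ℕ) : ℕ∞) < G.egirth) {p v : V} (hpv : G.Adj p v) {t : ℝ}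
    (ht : t ∈ Set.Icc (0 : ℝ) 1) :
    ∫ x, (if x v < t then truncatedGreedy G k p v x else 0)
      ∂(Measure.pi fun _ : V => uniformLaw) = treeProb (r - 1) k t := by
  induction k generalizing p v t with
  | zero => simp [truncatedGreedy, treeProb]
  | succ k ih =>
    have hk' : ((2 * (k - 1) : ℕ) : ℕ∞) < G.egirth :=
      lt_of_le_of_lt (by exact_mod_cast (by omega)) hk
    rw [integral_pi_eq_integral_update v (integrable_ite_truncatedGreedy G (k + 1) p v t _)]
    have h1 : ∀ᵐ s ∂uniformLaw, ∫ x, (if Function.update x v s v < t then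
        truncatedGreedy G (k + 1) p v (Function.update x v s) else 0)
          ∂(Measure.pi fun _ : V => uniformLaw) =
        if s < t then (1 - treeProb (r - 1) k s) ^ (r - 1) else 0 := by
      filter_upwards [ae_restrict_mem measurableSet_Icc] with s hs
      simp only [Function.update_self]
      split_ifs with hst
      · rw [integral_truncatedGreedy_update G (k := k) hk p v fun u hu =>
          ih hk' ((G.mem_neighborFinset v u).1 (Finset.mem_of_mem_erase hu)) hs,
          Finset.card_erase_of_mem (by simpa using hpv.symm),
          SimpleGraph.card_neighborFinset_eq_degree, hr v]
      · simp
    rw [integral_congr_ae h1, integral_uniformLaw_ite_lt ht]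
    rfl

/-- The mean of the truncated recursion at depth `k` is as on the infinite regular tree, if
the graph has no cycles of length at most `2 * k`. -/
theorem integral_truncatedGreedy_self {r : ℕ} (hr : G.IsRegularOfDegree r) {k : ℕ}
    (hk : ((2 * k : ℕ) : ℕ∞) < G.egirth) (v : V) :
    ∫ x, truncatedGreedy G (k + 1) v v x ∂(Measure.pi fun _ : V => uniformLaw) =
      ∫ s in (0 : ℝ)..1, (1 - treeProb (r - 1) k s) ^ r := by
  have hk' : ((2 * (k - 1) : ℕ) : ℕ∞) < G.egirth :=
    lt_of_le_of_lt (by exact_mod_cast (by omega)) hk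
  rw [integral_pi_eq_integral_update v (integrable_truncatedGreedy G (k + 1) v v _)]
  have h1 : ∀ᵐ s ∂uniformLaw, ∫ x, truncatedGreedy G (k + 1) v v (Function.update x v s)
      ∂(Measure.pi fun _ : V => uniformLaw) = (1 - treeProb (r - 1) k s) ^ r := by
    filter_upwards [ae_restrict_mem measurableSet_Icc] with s hs
    rw [integral_truncatedGreedy_update G hk v v fun u hu =>
      integral_ite_truncatedGreedy G hr k hk'
        ((G.mem_neighborFinset v u).1 (Finset.mem_of_mem_erase hu)) hs,
      Finset.erase_eq_of_notMem (by simp), SimpleGraph.card_neighborFinset_eq_degree, hr v]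
  rw [integral_congr_ae h1, intervalIntegral.integral_of_le zero_le_one,
    integral_Icc_eq_integral_Ioc]

end LocalRecursion

/-! ### Convergence of the tree recursion and its explicit limit -/

theorem continuous_treeProb (d k : ℕ) : Continuous (treeProb d k) := by
  induction k with
  | zero => exact continuous_const
  | succ k ih =>
    exact intervalIntegral.continuous_primitive
      (fun a b => ((continuous_const.sub ih).pow d).intervalIntegrable a b) 0

theorem integral_one_sub_pow_mem_Icc {A : ℝ → ℝ} (hc : ContinuousOn A (Set.Icc 0 1))
    (hA : ∀ s ∈ Set.Icc (0 : ℝ) 1, A s ∈ Set.Icc (0 : ℝ) 1) (n : ℕ) {t : ℝ}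
    (ht : t ∈ Set.Icc (0 : ℝ) 1) :
    ∫ s in (0 : ℝ)..t, (1 - A s) ^ n ∈ Set.Icc (0 : ℝ) 1 := by
  have hsub : Set.Icc 0 t ⊆ Set.Icc (0 : ℝ) 1 := Set.Icc_subset_Icc_right ht.2
  have hi : IntervalIntegrable (fun s => (1 - A s) ^ n) volume 0 t :=
    ((continuousOn_const.sub (hc.mono hsub)).pow n).intervalIntegrable_of_Icc ht.1
  refine ⟨intervalIntegral.integral_nonneg ht.1 fun s hs => ?_, ?_⟩
  · exact pow_nonneg (by linarith [(hA s (hsub hs)).2]) _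
  · calc ∫ s in (0 : ℝ)..t, (1 - A s) ^ n ≤ ∫ s in (0 : ℝ)..t, (1 : ℝ) := by
          refine intervalIntegral.integral_mono_on ht.1 hi intervalIntegrable_const fun s hs => ?_
          exact pow_le_one₀ (by linarith [(hA s (hsub hs)).2]) (by linarith [(hA s (hsub hs)).1])
      _ ≤ 1 := by simpa using ht.2

theorem treeProb_mem_Icc (d k : ℕ) {t : ℝ} (ht : t ∈ Set.Icc (0 : ℝ) 1) :
    treeProb d k t ∈ Set.Icc (0 : ℝ) 1 := by
  induction k generalizing t with
  | zero => simp [treeProb]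
  | succ k ih =>
    exact integral_one_sub_pow_mem_Icc (continuous_treeProb d k).continuousOn (fun s hs => ih hs)
      d ht

theorem integral_one_sub_pow_anti {A B : ℝ → ℝ} (hA : ContinuousOn A (Set.Icc 0 1))
    (hB : ContinuousOn B (Set.Icc 0 1)) (hAB : ∀ s ∈ Set.Icc (0 : ℝ) 1, A s ≤ B s)
    (hB1 : ∀ s ∈ Set.Icc (0 : ℝ) 1, B s ≤ 1) (n : ℕ) {t : ℝ} (ht : t ∈ Set.Icc (0 : ℝ) 1) :
    ∫ s in (0 : ℝ)..t, (1 - B s) ^ n ≤ ∫ s in (0 : ℝ)..t, (1 - A s) ^ n := by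
  have hsub : Set.Icc 0 t ⊆ Set.Icc (0 : ℝ) 1 := Set.Icc_subset_Icc_right ht.2
  have hi {C : ℝ → ℝ} (hC : ContinuousOn C (Set.Icc 0 1)) :
      IntervalIntegrable (fun s => (1 - C s) ^ n) volume 0 t :=
    ((continuousOn_const.sub (hC.mono hsub)).pow n).intervalIntegrable_of_Icc ht.1
  refine intervalIntegral.integral_mono_on ht.1 (hi hB) (hi hA) fun s hs => ?_
  exact pow_le_pow_left₀ (by linarith [hB1 s (hsub hs)]) (by linarith [hAB s (hsub hs)]) n

/-- The Picard step: `x ↦ (1 - x) ^ n` is `n`-Lipschitz on the unit interval, and integrating `s ^ m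
/ m!` produces the next factorial. It serves with `n = d` inside the tree and with `n = r` at the
root. -/
theorem abs_integral_one_sub_pow_sub_le {A B : ℝ → ℝ} (hA : Continuous A) (hB : Continuous B)
    (hA1 : ∀ s ∈ Set.Icc (0 : ℝ) 1, A s ∈ Set.Icc (0 : ℝ) 1)
    (hB1 : ∀ s ∈ Set.Icc (0 : ℝ) 1, B s ∈ Set.Icc (0 : ℝ) 1) {C : ℝ} {m : ℕ}
    (hAB : ∀ s ∈ Set.Icc (0 : ℝ) 1, |A s - B s| ≤ C * s ^ m / m.factorial) (n : ℕ) {t : ℝ}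
    (ht : t ∈ Set.Icc (0 : ℝ) 1) :
    |(∫ s in (0 : ℝ)..t, (1 - A s) ^ n) - ∫ s in (0 : ℝ)..t, (1 - B s) ^ n| ≤
      n * C * t ^ (m + 1) / (m + 1).factorial := by
  have hi {D : ℝ → ℝ} (hD : Continuous D) :
      IntervalIntegrable (fun s => (1 - D s) ^ n) volume 0 t :=
    ((continuous_const.sub hD).pow n).intervalIntegrable _ _
  rw [← intervalIntegral.integral_sub (hi hA) (hi hB)]
  calc |∫ s in (0 : ℝ)..t, ((1 - A s) ^ n - (1 - B s) ^ n)|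
      ≤ ∫ s in (0 : ℝ)..t, |(1 - A s) ^ n - (1 - B s) ^ n| :=
        intervalIntegral.abs_integral_le_integral_abs ht.1
    _ ≤ ∫ s in (0 : ℝ)..t, n * C / m.factorial * s ^ m := by
        refine intervalIntegral.integral_mono_on ht.1 ((hi hA).sub (hi hB)).abs
          (Continuous.intervalIntegrable (by fun_prop) _ _) fun s hs => ?_
        have hs' : s ∈ Set.Icc (0 : ℝ) 1 := ⟨hs.1, hs.2.trans ht.2⟩
        have h1 := abs_pow_sub_pow_le (1 - A s) (1 - B s) n
        have h2 : max |1 - A s| |1 - B s| ^ (n - 1) ≤ 1 := by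
          refine pow_le_one₀ (le_max_of_le_left (abs_nonneg _)) (max_le ?_ ?_)
          · rw [abs_le]; constructor <;> linarith [(hA1 s hs').1, (hA1 s hs').2]
          · rw [abs_le]; constructor <;> linarith [(hB1 s hs').1, (hB1 s hs').2]
        have h3 : |1 - A s - (1 - B s)| = |A s - B s| := by
          rw [abs_sub_comm]; congr 1; ring
        rw [h3] at h1
        calc _ ≤ |A s - B s| * n * max |1 - A s| |1 - B s| ^ (n - 1) := h1
          _ ≤ |A s - B s| * n * 1 := by gcongr
          _ ≤ (C * s ^ m / m.factorial) * n * 1 := by gcongr; exact hAB s hs'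
          _ = _ := by ring
    _ = n * C * t ^ (m + 1) / (m + 1).factorial := by
        rw [intervalIntegral.integral_const_mul, integral_pow, Nat.factorial_succ]
        push_cast
        field_simp
        ring

theorem abs_treeProb_succ_sub_le (d k : ℕ) {t : ℝ} (ht : t ∈ Set.Icc (0 : ℝ) 1) :
    |treeProb d (k + 1) t - treeProb d k t| ≤ (d : ℝ) ^ k * t ^ (k + 1) / (k + 1).factorial := by
  induction k generalizing t with
  | zero => simp [treeProb, abs_of_nonneg ht.1]
  | succ k ih =>
    rw [pow_succ' (d : ℝ) k]
    exact abs_integral_one_sub_pow_sub_le (continuous_treeProb d _) (continuous_treeProb d _)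
      (fun s hs => treeProb_mem_Icc d _ hs) (fun s hs => treeProb_mem_Icc d _ hs)
      (fun s hs => ih hs) d ht

/-- The limit of `treeProb (c + 1) k t` as the depth `k` grows, for `c > 0`. -/
noncomputable def limitProb (c : ℕ) (t : ℝ) : ℝ := 1 - (1 + c * t) ^ (-(1 / (c : ℝ)))

/-- Differentiating the fixed-point equation for `y = 1 - limitProb c` gives `y' = -y ^ (c + 1)`
with `y 0 = 1`, which this power solves. -/
theorem hasDerivAt_one_add_mul_rpow {c : ℕ} (hc : 0 < c) {t : ℝ} (ht : 0 ≤ t) :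
    HasDerivAt (fun s : ℝ => (1 + c * s) ^ (-(1 / (c : ℝ))))
      (-((1 + c * t) ^ (-(1 / (c : ℝ)))) ^ (c + 1)) t := by
  have hc' : (0 : ℝ) < c := by exact_mod_cast hc
  have hpos : 0 < 1 + c * t := by positivity
  have h1 : HasDerivAt (fun s : ℝ => 1 + c * s) (c : ℝ) t := by
    simpa using ((hasDerivAt_id t).const_mul (c : ℝ)).const_add 1
  convert h1.rpow_const (p := -(1 / (c : ℝ))) (Or.inl hpos.ne') using 1
  rw [← Real.rpow_natCast, ← Real.rpow_mul hpos.le]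
  have : -(1 / (c : ℝ)) * ((c + 1 : ℕ) : ℝ) = -(1 / (c : ℝ)) - 1 := by
    push_cast
    field_simp
    ring
  rw [this]
  field_simp

theorem continuousOn_limitProb {c : ℕ} (hc : 0 < c) : ContinuousOn (limitProb c) (Set.Icc 0 1) :=
  fun _ ht => (continuousAt_const.sub
    (hasDerivAt_one_add_mul_rpow hc ht.1).continuousAt).continuousWithinAt

theorem limitProb_mem_Icc (c : ℕ) {t : ℝ} (ht : t ∈ Set.Icc (0 : ℝ) 1) :
    limitProb c t ∈ Set.Icc (0 : ℝ) 1 := by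
  have h0 := ht.1
  have h1 : (1 + c * t) ^ (-(1 / (c : ℝ))) ≤ 1 :=
    Real.rpow_le_one_of_one_le_of_nonpos (by nlinarith [(Nat.cast_nonneg c : (0 : ℝ) ≤ c)])
      (by simp)
  have h2 : 0 ≤ (1 + c * t) ^ (-(1 / (c : ℝ))) := by positivity
  rw [limitProb]
  exact ⟨by linarith, by linarith⟩

theorem integral_one_sub_limitProb_pow {c : ℕ} (hc : 0 < c) {t : ℝ}
    (ht : t ∈ Set.Icc (0 : ℝ) 1) :
    ∫ s in (0 : ℝ)..t, (1 - limitProb c s) ^ (c + 1) = limitProb c t := by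
  have hsub : Set.Icc 0 t ⊆ Set.Icc (0 : ℝ) 1 := Set.Icc_subset_Icc_right ht.2
  have hd : ∀ s ∈ Set.uIcc 0 t, HasDerivAt (limitProb c) ((1 - limitProb c s) ^ (c + 1)) s := by
    intro s hs
    rw [Set.uIcc_of_le ht.1] at hs
    refine ((hasDerivAt_one_add_mul_rpow hc hs.1).const_sub 1).congr_deriv ?_
    simp [limitProb]
  rw [intervalIntegral.integral_eq_sub_of_hasDerivAt hd
    (((continuousOn_const.sub ((continuousOn_limitProb hc).mono hsub)).pow
      _).intervalIntegrable_of_Icc ht.1)]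
  simp [limitProb]

theorem integral_one_sub_limitProb_pow_eq_greedyDensity {r : ℕ} (hr : 3 ≤ r) :
    ∫ s in (0 : ℝ)..1, (1 - limitProb (r - 2) s) ^ r = greedyDensity r := by
  obtain ⟨c, rfl⟩ : ∃ c, r = c + 2 := ⟨r - 2, by omega⟩
  have hc : 0 < c := by omega
  rw [Nat.add_sub_cancel]
  -- With `y = 1 - limitProb c`, the equation `y' = -y ^ (c + 1)` gives `y ^ (c + 2) = -y * y'`, the
  -- derivative of `-y ^ 2 / 2`.
  have hd : ∀ s ∈ Set.uIcc (0 : ℝ) 1,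
      HasDerivAt (fun s : ℝ => -(((1 + c * s) ^ (-(1 / (c : ℝ)))) ^ 2 / 2))
        ((1 - limitProb c s) ^ (c + 2)) s := by
    intro s hs
    rw [Set.uIcc_of_le zero_le_one] at hs
    refine (((hasDerivAt_one_add_mul_rpow hc hs.1).pow 2).div_const 2).neg.congr_deriv ?_
    simp only [limitProb]
    push_cast
    ring
  rw [intervalIntegral.integral_eq_sub_of_hasDerivAt hd
    (((continuousOn_const.sub (continuousOn_limitProb hc)).pow
      _).intervalIntegrable_of_Icc zero_le_one)]
  have h1 : ((1 + c * (1 : ℝ)) ^ (-(1 / (c : ℝ)))) ^ 2 = (1 + (c : ℝ)) ^ (-(2 / (c : ℝ))) := by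
    rw [← Real.rpow_natCast, ← Real.rpow_mul (by positivity), mul_one]
    congr 1
    push_cast
    ring
  have h2 : ((c + 2 : ℕ) : ℝ) - 1 = 1 + c := by push_cast; ring
  have h3 : ((c + 2 : ℕ) : ℝ) - 2 = c := by push_cast; ring
  rw [h1, greedyDensity, h2, h3]
  simp
  ring

/-- Both sides are images under the same order-reversing operator, which fixes `limitProb c`; the
iteration starts below it, at 0. -/
theorem treeProb_limitProb_bounds {c : ℕ} (hc : 0 < c) (k : ℕ) {t : ℝ}
    (ht : t ∈ Set.Icc (0 : ℝ) 1) :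
    (Even k → treeProb (c + 1) k t ≤ limitProb c t) ∧
      (¬ Even k → limitProb c t ≤ treeProb (c + 1) k t) := by
  induction k generalizing t with
  | zero => exact ⟨fun _ => (limitProb_mem_Icc c ht).1, fun h => absurd Even.zero h⟩
  | succ k ih =>
    rw [← integral_one_sub_limitProb_pow hc ht, Nat.even_add_one, not_not]
    exact ⟨fun hk => integral_one_sub_pow_anti (continuousOn_limitProb hc)
        (continuous_treeProb _ k).continuousOn (fun s hs => (ih hs).2 hk)
        (fun s hs => (treeProb_mem_Icc _ k hs).2) _ ht,
      fun hk => integral_one_sub_pow_anti (continuous_treeProb _ k).continuousOn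
        (continuousOn_limitProb hc) (fun s hs => (ih hs).1 hk)
        (fun s hs => (limitProb_mem_Icc _ hs).2) _ ht⟩

theorem greedyDensity_bounds {r : ℕ} (hr : 3 ≤ r) (k : ℕ) :
    (Even k → greedyDensity r ≤ ∫ s in (0 : ℝ)..1, (1 - treeProb (r - 1) k s) ^ r) ∧
      (¬ Even k → ∫ s in (0 : ℝ)..1, (1 - treeProb (r - 1) k s) ^ r ≤ greedyDensity r) := by
  have hc : 0 < r - 2 := by omega
  have hr1 : r - 1 = r - 2 + 1 := by omega
  have h1 : (1 : ℝ) ∈ Set.Icc (0 : ℝ) 1 := by simp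
  rw [← integral_one_sub_limitProb_pow_eq_greedyDensity hr, hr1]
  exact ⟨fun hk => integral_one_sub_pow_anti (continuous_treeProb _ k).continuousOn
      (continuousOn_limitProb hc) (fun s hs => (treeProb_limitProb_bounds hc k hs).1 hk)
      (fun s hs => (limitProb_mem_Icc _ hs).2) _ h1,
    fun hk => integral_one_sub_pow_anti (continuousOn_limitProb hc)
      (continuous_treeProb _ k).continuousOn (fun s hs => (treeProb_limitProb_bounds hc k hs).2 hk)
      (fun s hs => (treeProb_mem_Icc _ k hs).2) _ h1⟩

/-! ### The expected ratio between consecutive truncations -/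

section Ratio

variable {V : Type u} [DecidableEq V] [Fintype V] (G : SimpleGraph V) [DecidableRel G.Adj]

/-- The root adds one level to the recursion: depth `k` in the branches is depth `k + 1` at the
root, so even `k` gives an upper bound. -/
theorem expectedGreedyRatio_bounds [Nonempty V] {r : ℕ} (hr : G.IsRegularOfDegree r) {k : ℕ}
    (hk : ((2 * k : ℕ) : ℕ∞) < G.egirth) :
    (Even k → expectedGreedyRatio G ≤ ∫ s in (0 : ℝ)..1, (1 - treeProb (r - 1) k s) ^ r) ∧
      (¬ Even k → ∫ s in (0 : ℝ)..1, (1 - treeProb (r - 1) k s) ^ r ≤ expectedGreedyRatio G) := by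
  set T := ∫ s in (0 : ℝ)..1, (1 - treeProb (r - 1) k s) ^ r
  have hV : (0 : ℝ) < Fintype.card V := by exact_mod_cast Fintype.card_pos
  have h (v : V) : orderMean (Fintype.card V) Finset.univ
      (fun l => truncatedGreedy G (k + 1) v v fun w => l.idxOf w) = T := by
    rw [orderMean_eq_integral (ν := uniformLaw)
      (fun x y => truncatedGreedy_congr G (k + 1) v v) (integrable_truncatedGreedy G _ _ _ _),
      integral_truncatedGreedy_self G hr hk v]
  have hT : (∑ _v : V, T) = T * Fintype.card V := by simp [mul_comm]
  rw [expectedGreedyRatio_eq]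
  constructor <;> intro hk'
  · rw [div_le_iff₀ hV, ← hT]
    refine Finset.sum_le_sum fun v _ => ?_
    rw [← h v]
    refine orderMean_mono Finset.card_univ fun l hl hlV => ?_
    exact (indicator_greedyList_bounds G hl hlV (k + 1) (Or.inl rfl)).2
      (by rwa [Nat.even_add_one, not_not])
  · rw [le_div_iff₀ hV, ← hT]
    refine Finset.sum_le_sum fun v _ => ?_
    rw [← h v]
    refine orderMean_mono Finset.card_univ fun l hl hlV => ?_
    exact (indicator_greedyList_bounds G hl hlV (k + 1) (Or.inl rfl)).1
      (by rwa [Nat.even_add_one])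

/-- The ratio and the density lie between the same two consecutive tree values, so they differ by at
most the gap between those. -/
theorem abs_expectedGreedyRatio_sub_le [Nonempty V] {r : ℕ} (hr3 : 3 ≤ r)
    (hr : G.IsRegularOfDegree r) {k : ℕ} (hk : ((2 * (k + 1) : ℕ) : ℕ∞) < G.egirth) :
    |expectedGreedyRatio G - greedyDensity r| ≤
      r * ((r : ℝ) - 1) ^ k / (k + 2).factorial := by
  have hk' : ((2 * k : ℕ) : ℕ∞) < G.egirth := lt_of_le_of_lt (by exact_mod_cast (by omega)) hk
  have h1 := abs_integral_one_sub_pow_sub_le (continuous_treeProb (r - 1) (k + 1))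
    (continuous_treeProb (r - 1) k) (fun s hs => treeProb_mem_Icc _ _ hs)
    (fun s hs => treeProb_mem_Icc _ _ hs) (fun s hs => abs_treeProb_succ_sub_le (r - 1) k hs) r
    (t := 1) (by simp)
  rw [one_pow, mul_one, Nat.cast_sub (by omega), Nat.cast_one] at h1
  refine le_trans ?_ h1
  have ha := greedyDensity_bounds hr3 k
  have hb := greedyDensity_bounds hr3 (k + 1)
  have hc := expectedGreedyRatio_bounds G hr hk'
  have hd := expectedGreedyRatio_bounds G hr hk
  rw [Nat.even_add_one, not_not] at hb hd
  by_cases he : Even k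
  · refine (abs_le.2 ⟨?_, ?_⟩).trans (neg_le_abs _) <;>
    linarith [ha.1 he, hb.2 he, hc.1 he, hd.2 he]
  · refine (abs_le.2 ⟨?_, ?_⟩).trans (le_abs_self _) <;>
    linarith [ha.2 he, hb.1 he, hc.2 he, hd.1 he]

theorem abs_expectedGreedyRatio_sub_le_girthCorrection [Nonempty V] {g r : ℕ} (hg : 4 ≤ g)
    (hr3 : 3 ≤ r) (hr : G.IsRegularOfDegree r) (hgirth : (g : ℕ∞) ≤ G.egirth) :
    |expectedGreedyRatio G - greedyDensity r| ≤ girthCorrection g r := by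
  -- Here `2 * (k + 1) ≤ g - 2 < g`. The estimate has the exponent `k` where `girthCorrection` has
  -- `k + 1`, so a factor `r - 1 ≥ 1` is given away.
  obtain ⟨k, hk⟩ : ∃ k, (g - 2) / 2 = k + 1 := ⟨(g - 2) / 2 - 1, by omega⟩
  refine (abs_expectedGreedyRatio_sub_le G hr3 hr (k := k)
    (lt_of_lt_of_le (by exact_mod_cast (by omega)) hgirth)).trans ?_
  rw [girthCorrection, hk]
  have : (3 : ℝ) ≤ r := by exact_mod_cast hr3
  gcongr
  · linarith
  · omega

end Ratio

theorem theorem4 (g r : ℕ) (hg : 4 ≤ g) (hr : 3 ≤ r) :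
    ((greedyDensity r - girthCorrection g r : ℝ) : EReal) ≤ infGreedyRatio.{u} g r ∧
      infGreedyRatio.{u} g r ≤ supGreedyRatio.{u} g r ∧
      supGreedyRatio.{u} g r ≤ ((greedyDensity r + girthCorrection g r : ℝ) : EReal) := by
  have h (G : RegularGirthGraph.{u} g r) := abs_le.1
    (abs_expectedGreedyRatio_sub_le_girthCorrection G.graph hg hr G.regular G.girth)
  -- `iInf_le_iSup` relies on `RegularGirthGraph.instNonempty`; over an empty class the infimum
  -- would be `⊤` and the supremum `⊥`.
  refine ⟨le_iInf fun G => ?_, iInf_le_iSup, iSup_le fun G => ?_⟩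
  · exact EReal.coe_le_coe_iff.2 (by linarith [(h G).1])
  · exact EReal.coe_le_coe_iff.2 (by linarith [(h G).2])
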